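/- Consider bounded linear operators on the complex Hilbert space $\ell^2(\mathbb N)$, with matrices $X=(x_{i,j})$ with respect to the canonical orthonormal basis $(e_i)$, $x_{i,j}=\langle Xe_j,e_i\rangle$, and with the operator norm. Let $E(X)$ denote the diagonal operator with the same diagonal entries as $X$, let $P_A$ (for $A\subseteq\mathbb N$) denote the diagonal projection whose $i$-th diagonal entry is $1$ if $i\in A$ and $0$ otherwise, and let $\mathcal T_0(\mathbb N)$ denote the set of bounded operators that are strictly upper triangular, i.e. $t_{i,j}=0$ for all $i\ge j$. An $r$-paving of $\mathbb N$ is a collection $\{A_1,\dots,A_r\}$ of pairwise disjoint (possibly empty) sets with $A_1\cup\dots\cup A_r=\mathbb N$. The following are equivalent: (i) for each $\varepsilon>0$ there exists $r_1\in\mathbb N$ such that for every bounded operator $H=H^*$ on $\ell^2(\mathbb N)$ with $E(H)=0$ there exists an $r_1$-paving $\{A_1,\dots,A_{r_1}\}$ of $\mathbb N$ with $\|P_{A_i}HP_{A_i}\|\le\varepsilon\|H\|$ for $i=1,\dots,r_1$; (ii) for each $\varepsilon>0$ there exists $r_2\in\mathbb N$ such that for every $T\in\mathcal T_0(\mathbb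 N)$ there exists an $r_2$-paving $\{A_1,\dots,A_{r_2}\}$ of $\mathbb N$ with $\|P_{A_i}TP_{A_i}\|\le\varepsilon\|T\|$ for $i=1,\dots,r_2$. -/

import Mathlib

open scoped ENNReal

noncomputable section

namespace Paving

/-- The Hilbert space of square-summable complex sequences indexed by `ℕ`. -/
abbrev L2N : Type := lp (fun _ : ℕ => ℂ) 2

/-- The `C⋆`-algebra of bounded operators on `ℓ²(ℕ)`. -/
abbrev BL2N : Type := L2N →L[ℂ] L2N

/-- The bounded complex sequences. -/
abbrev LInfN : Type := lp (fun _ : ℕ => ℂ) ∞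

/-- The canonical orthonormal basis vectors of `ℓ²(ℕ)`. -/
def e (j : ℕ) : L2N := lp.single 2 j (1 : ℂ)

/-- The `(i, j)` entry `⟨X e_j, e_i⟩` of the matrix of `X`, i.e. the `i`-th coordinate of
`X e_j`. -/
def entry (X : BL2N) (i j : ℕ) : ℂ := (X (e j)) i

theorem entry_eq_inner (X : BL2N) (i j : ℕ) : entry X i j = inner ℂ (e i) (X (e j)) := by
  simp [entry, e, lp.inner_single_left]

theorem norm_entry_le (X : BL2N) (i j : ℕ) : ‖entry X i j‖ ≤ ‖X‖ := by
  have h1 : ‖(X (e j)) i‖ ≤ ‖X (e j)‖ := lp.norm_apply_le_norm (by norm_num) _ i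
  have h2 : ‖e j‖ = 1 := by simp [e, lp.norm_single (p := 2) (by norm_num)]
  calc ‖entry X i j‖ ≤ ‖X (e j)‖ := h1
    _ ≤ ‖X‖ * ‖e j‖ := X.le_opNorm _
    _ = ‖X‖ := by rw [h2, mul_one]

theorem memℓp_mul (d : LInfN) (x : L2N) : Memℓp (fun i => d i * x i) 2 := by
  refine ((lp.memℓp x).const_mul (‖d‖ : ℂ)).mono' (fun i => ?_)
  have hd : ‖d i‖ ≤ ‖d‖ := lp.norm_apply_le_norm (by norm_num) d i
  simpa using mul_le_mul_of_nonneg_right hd (norm_nonneg (x i))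

/-- The diagonal operator with diagonal `d`, `(x_i) ↦ (d_i x_i)`. -/
def diagOp (d : LInfN) : BL2N :=
  LinearMap.mkContinuous
    { toFun := fun x => ⟨fun i => d i * x i, memℓp_mul d x⟩
      map_add' := fun x y => by ext i; exact mul_add (d i) (x i) (y i)
      map_smul' := fun c x => by ext i; simp [mul_left_comm] }
    ‖d‖
    (fun x => by
      have hx : ‖((‖d‖ : ℂ) • x : L2N)‖ = ‖d‖ * ‖x‖ := by
        rw [norm_smul, Complex.norm_real, norm_norm]
      rw [← hx]
      refine lp.norm_mono (by norm_num) (fun i => ?_)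
      have hd : ‖d i‖ ≤ ‖d‖ := lp.norm_apply_le_norm (by norm_num) d i
      have hr : ‖((‖d‖ : ℂ) • x : L2N) i‖ = ‖d‖ * ‖x i‖ := by
        rw [lp.coeFn_smul, Pi.smul_apply, norm_smul, Complex.norm_real, norm_norm]
      have hl : ‖d i * x i‖ = ‖d i‖ * ‖x i‖ := norm_mul _ _
      exact hl.trans_le ((mul_le_mul_of_nonneg_right hd (norm_nonneg (x i))).trans hr.ge))

@[simp] theorem diagOp_apply (d : LInfN) (x : L2N) (i : ℕ) : (diagOp d x) i = d i * x i := rfl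

/-- The diagonal sequence `(x_{i,i})` of the matrix of `X`. -/
def diagSeq (X : BL2N) : LInfN :=
  ⟨fun i => entry X i i, memℓp_infty ⟨‖X‖, by rintro _ ⟨i, rfl⟩; exact norm_entry_le X i i⟩⟩

/-- The conditional expectation of `B(ℓ²(ℕ))` onto the diagonal operators: it keeps the diagonal
entries of the matrix and replaces all other entries by `0`. -/
def condExpDiag (X : BL2N) : BL2N := diagOp (diagSeq X)

open Classical in
/-- The diagonal projection `P_A`: its `i`-th diagonal entry is `1` if `i ∈ A` and `0` otherwise. -/
def proj (A : Set ℕ) : BL2N :=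
  diagOp ⟨fun i => if i ∈ A then 1 else 0,
    memℓp_infty ⟨1, by rintro _ ⟨i, rfl⟩; dsimp only; split_ifs <;> simp⟩⟩

theorem entry_condExpDiag (X : BL2N) (i j : ℕ) :
    entry (condExpDiag X) i j = if i = j then entry X i i else 0 := by
  by_cases h : i = j
  · subst h
    simp [entry, condExpDiag, diagSeq, e]
  · simp [entry, condExpDiag, e, h]

open Classical in
theorem proj_apply (A : Set ℕ) (x : L2N) (i : ℕ) :
    (proj A x) i = if i ∈ A then x i else 0 := by
  simp [proj]

/-- `𝒯₀(ℕ)`: the strictly upper triangular operators, those whose matrix satisfies `t_{i,j} = 0`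
for all `i ≥ j`. -/
def strictlyUpperTriangular : Set BL2N := {T | ∀ i j : ℕ, i ≥ j → entry T i j = 0}

/-- An `r`-paving of `ℕ`: disjoint sets `A_1, …, A_r` with union `ℕ`. -/
structure IsPaving {r : ℕ} (A : Fin r → Set ℕ) : Prop where
  disjoint : Pairwise fun i j => Disjoint (A i) (A j)
  iUnion_eq : ⋃ i, A i = Set.univ

end Paving

end

open scoped InnerProductSpace

namespace Paving

/-! From (i) to (ii), split `T` into real and imaginary parts, which have zero diagonal, and
intersect their pavings. From (ii) to (i), normalize to `‖H‖ ≤ 1` and factor the positive operator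
`1 + sH` for small `s`: Gram–Schmidt applied to the columns of its square root gives an upper
triangular `U = D + T` with `U*U ≤ 1 + sH` (`exists_strictlyUpperTriangular_minorant`). Since `H`
has zero diagonal, its first-order effect on the diagonal of `U` vanishes: `|dⱼ|² ≥ 1 - 2s²`. On a
block where `T` compresses to norm at most `η`, `U` is close to `D`, so `s⟪Hx, x⟫ ≥ -(2s² + 5η)‖x‖²`
(`neg_le_of_norm_compression_le`). Division by `s` leaves an error `2s + 5η/s`, which is small when
`η` is of order `s²`. The same bound for `-H` and a common refinement control the norm. -/

theorem norm_e (j : ℕ) : ‖e j‖ = 1 := by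
  simp [e, lp.norm_single (p := 2) (by norm_num)]

theorem e_apply (i j : ℕ) : e j i = if i = j then (1 : ℂ) else 0 := by
  by_cases h : i = j
  · subst h; simp [e]
  · simp [e, h]

theorem inner_e_left (i : ℕ) (x : L2N) : ⟪e i, x⟫_ℂ = x i := by
  simp [e, lp.inner_single_left]

theorem orthonormal_e : Orthonormal ℂ e := by
  rw [orthonormal_iff_ite]
  intro i j
  rw [inner_e_left, e_apply]

theorem diagOp_norm_le (d : LInfN) : ‖diagOp d‖ ≤ ‖d‖ :=
  LinearMap.mkContinuous_norm_le _ (norm_nonneg _) _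

theorem norm_diagSeq_le (X : BL2N) : ‖diagSeq X‖ ≤ ‖X‖ :=
  lp.norm_le_of_forall_le (norm_nonneg _) fun i => norm_entry_le X i i

theorem condExpDiag_norm_le (X : BL2N) : ‖condExpDiag X‖ ≤ ‖X‖ :=
  (diagOp_norm_le _).trans (norm_diagSeq_le X)

theorem condExpDiag_eq_zero_iff (X : BL2N) : condExpDiag X = 0 ↔ ∀ i, entry X i i = 0 := by
  constructor
  · intro h i
    have := entry_condExpDiag X i i
    rw [h] at this
    simpa [entry] using this.symm
  · intro h
    ext x i
    simp [condExpDiag, diagSeq, h]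

theorem entry_add (X Y : BL2N) (i j : ℕ) : entry (X + Y) i j = entry X i j + entry Y i j := by
  simp [entry]

theorem entry_sub (X Y : BL2N) (i j : ℕ) : entry (X - Y) i j = entry X i j - entry Y i j := by
  simp [entry]

theorem entry_smul (c : ℂ) (X : BL2N) (i j : ℕ) : entry (c • X) i j = c * entry X i j := by
  simp [entry]

theorem entry_star (X : BL2N) (i j : ℕ) : entry (star X) i j = star (entry X j i) := by
  rw [entry_eq_inner, entry_eq_inner, ContinuousLinearMap.star_eq_adjoint,
    ContinuousLinearMap.adjoint_inner_right, ← inner_conj_symm]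
  rfl

theorem norm_sq_eq_tsum (x : L2N) : ‖x‖ ^ 2 = ∑' i, ‖x i‖ ^ 2 := by
  have := lp.norm_rpow_eq_tsum (p := 2) (by norm_num) x
  simpa using this

theorem summable_norm_sq (x : L2N) : Summable fun i => ‖x i‖ ^ 2 := by
  have := (lp.memℓp x).summable (by norm_num)
  simpa using this

/-- Multiplication by a sequence bounded below is bounded below. -/
theorem le_norm_sq_diagOp (d : LInfN) {c : ℝ} (hd : ∀ i, c ≤ ‖d i‖ ^ 2) (x : L2N) :
    c * ‖x‖ ^ 2 ≤ ‖diagOp d x‖ ^ 2 := by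
  rw [norm_sq_eq_tsum, norm_sq_eq_tsum, ← tsum_mul_left]
  refine Summable.tsum_le_tsum (fun i => ?_) ((summable_norm_sq x).mul_left c)
    (summable_norm_sq _)
  rw [diagOp_apply, norm_mul, mul_pow]
  exact mul_le_mul_of_nonneg_right (hd i) (by positivity)

/-! ### Diagonal projections, compressions and refinements -/

theorem proj_norm_le (A : Set ℕ) : ‖proj A‖ ≤ 1 := by
  refine (diagOp_norm_le _).trans (lp.norm_le_of_forall_le zero_le_one fun i => ?_)
  dsimp only
  split_ifs <;> simp

theorem proj_inter (A B : Set ℕ) : proj (A ∩ B) = proj A * proj B := by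
  ext x i
  simp only [mul_apply_eq_comp, proj_apply]
  by_cases hA : i ∈ A <;> by_cases hB : i ∈ B <;> simp [hA, hB]

theorem proj_mul_self (A : Set ℕ) : proj A * proj A = proj A := by
  rw [← proj_inter, Set.inter_self]

theorem proj_commute_diagOp (A : Set ℕ) (d : LInfN) : proj A * diagOp d = diagOp d * proj A := by
  ext x i
  simp only [mul_apply_eq_comp, proj_apply, diagOp_apply]
  split_ifs <;> simp

theorem inner_proj_left (A : Set ℕ) (x y : L2N) : ⟪proj A x, y⟫_ℂ = ⟪x, proj A y⟫_ℂ := by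
  rw [lp.inner_eq_tsum, lp.inner_eq_tsum]
  congr 1
  ext i
  rw [proj_apply, proj_apply]
  split_ifs <;> simp

theorem isSelfAdjoint_proj (A : Set ℕ) : IsSelfAdjoint (proj A) :=
  ContinuousLinearMap.isSelfAdjoint_iff_isSymmetric.mpr (inner_proj_left A)

theorem norm_compression_inter_le_left (A B : Set ℕ) (X : BL2N) :
    ‖proj (A ∩ B) * X * proj (A ∩ B)‖ ≤ ‖proj A * X * proj A‖ := by
  have h : proj (A ∩ B) * X * proj (A ∩ B) = proj B * (proj A * X * proj A) * proj B := by
    conv_lhs => rw [proj_inter A B]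
    rw [show proj A * proj B = proj B * proj A by rw [← proj_inter, ← proj_inter, Set.inter_comm]]
    nth_rewrite 2 [show proj B * proj A = proj A * proj B by
      rw [← proj_inter, ← proj_inter, Set.inter_comm]]
    simp only [mul_assoc]
  rw [h]
  refine (norm_mul_le _ _).trans ((mul_le_of_le_one_right (norm_nonneg _) (proj_norm_le B)).trans ?_)
  exact (norm_mul_le _ _).trans (mul_le_of_le_one_left (norm_nonneg _) (proj_norm_le B))

theorem norm_compression_inter_le_right (A B : Set ℕ) (X : BL2N) :
    ‖proj (A ∩ B) * X * proj (A ∩ B)‖ ≤ ‖proj B * X * proj B‖ := by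
  rw [Set.inter_comm]
  exact norm_compression_inter_le_left B A X

/-- The common refinement of two pavings. -/
def refinement {r s : ℕ} (A : Fin r → Set ℕ) (B : Fin s → Set ℕ) (k : Fin (r * s)) : Set ℕ :=
  A (finProdFinEquiv.symm k).1 ∩ B (finProdFinEquiv.symm k).2

theorem IsPaving.refinement {r s : ℕ} {A : Fin r → Set ℕ} {B : Fin s → Set ℕ}
    (hA : IsPaving A) (hB : IsPaving B) : IsPaving (refinement A B) where
  disjoint := by
    intro k l hkl
    have hne : finProdFinEquiv.symm k ≠ finProdFinEquiv.symm l :=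
      fun h => hkl (finProdFinEquiv.symm.injective h)
    by_cases h : (finProdFinEquiv.symm k).1 = (finProdFinEquiv.symm l).1
    · have h2 : (finProdFinEquiv.symm k).2 ≠ (finProdFinEquiv.symm l).2 :=
        fun h2 => hne (Prod.ext h h2)
      exact (hB.disjoint h2).mono Set.inter_subset_right Set.inter_subset_right
    · exact (hA.disjoint h).mono Set.inter_subset_left Set.inter_subset_left
  iUnion_eq := by
    rw [Set.eq_univ_iff_forall]
    intro n
    obtain ⟨i, hi⟩ := Set.mem_iUnion.mp (hA.iUnion_eq.symm ▸ Set.mem_univ n : n ∈ ⋃ i, A i)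
    obtain ⟨j, hj⟩ := Set.mem_iUnion.mp (hB.iUnion_eq.symm ▸ Set.mem_univ n : n ∈ ⋃ i, B i)
    refine Set.mem_iUnion.mpr ⟨finProdFinEquiv (i, j), ?_⟩
    simp [Paving.refinement, hi, hj]

/-- A compression of a self-adjoint operator is controlled by its quadratic form on the range. -/
theorem norm_compression_le {H : BL2N} (hH : IsSelfAdjoint H) (A : Set ℕ) {c : ℝ} (hc : 0 ≤ c)
    (h : ∀ x, proj A x = x → |(⟪H x, x⟫_ℂ).re| ≤ c * ‖x‖ ^ 2) :
    ‖proj A * H * proj A‖ ≤ c := by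
  have hK : IsSelfAdjoint (proj A * H * proj A) := by
    have := hH.conjugate (proj A)
    rwa [(isSelfAdjoint_proj A).star_eq] at this
  rw [ContinuousLinearMap.norm_eq_iSup_rayleighQuotient _ hK.isSymmetric]
  refine ciSup_le fun x => ?_
  have hx : proj A (proj A x) = proj A x := by
    rw [← mul_apply_eq_comp, proj_mul_self]
  have hP : ‖proj A x‖ ≤ ‖x‖ := by
    simpa using (proj A).le_of_opNorm_le (proj_norm_le A) x
  have h1 : (proj A * H * proj A).reApplyInnerSelf x = (⟪H (proj A x), proj A x⟫_ℂ).re := by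
    rw [ContinuousLinearMap.reApplyInnerSelf_apply]
    simp only [mul_apply_eq_comp]
    rw [inner_proj_left]
    rfl
  rw [ContinuousLinearMap.rayleighQuotient, h1, abs_div, abs_of_nonneg (sq_nonneg ‖x‖)]
  refine div_le_of_le_mul₀ (by positivity) hc ((h _ hx).trans ?_)
  gcongr

/-! ### Triangular factorization by Gram–Schmidt -/

/-- The operator `x ↦ (⟪f i, x⟫)ᵢ` attached to an orthonormal sequence is a contraction. -/
theorem exists_coefficient_operator {f : ℕ → L2N} (hf : Orthonormal ℂ f) :
    ∃ W : BL2N, (∀ x, ‖W x‖ ≤ ‖x‖) ∧ ∀ x i, W x i = ⟪f i, x⟫_ℂ := by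
  let V : L2N →L[ℂ] L2N := hf.orthogonalFamily.linearIsometry.toContinuousLinearMap
  have hV : ‖V‖ ≤ 1 := LinearIsometry.norm_toContinuousLinearMap_le _
  refine ⟨ContinuousLinearMap.adjoint V, fun x => ?_, fun x i => ?_⟩
  · have : ‖ContinuousLinearMap.adjoint V‖ ≤ 1 := by
      rwa [LinearIsometryEquiv.norm_map]
    simpa using (ContinuousLinearMap.adjoint V).le_of_opNorm_le this x
  · rw [← inner_e_left, ContinuousLinearMap.adjoint_inner_right]
    have : V (e i) = f i := by
      simp [V, e, hf.orthogonalFamily.linearIsometry_apply_single]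
    rw [this]

/-- A bounded-below operator `S` has an upper triangular `U` with `‖U x‖ ≤ ‖S x‖` whose diagonal
entries are the distances from `S eⱼ` to the span of the earlier `S eᵢ`. -/
theorem exists_upperTriangular_factor (S : BL2N) (hS : Function.Injective S) {c : ℝ}
    (hc : ∀ (j : ℕ) (x : L2N), x j = 0 → c ≤ ‖S (e j - x)‖ ^ 2) :
    ∃ U : BL2N, (∀ x, ‖U x‖ ≤ ‖S x‖) ∧ (∀ i j, j < i → entry U i j = 0) ∧
      ∀ j, c ≤ ‖entry U j j‖ ^ 2 := by
  let v : ℕ → L2N := fun j => S (e j)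
  have hv : LinearIndependent ℂ v :=
    orthonormal_e.linearIndependent.map' (S : L2N →ₗ[ℂ] L2N) (LinearMap.ker_eq_bot.mpr hS)
  -- `W * S` is the triangular factor of a QR decomposition of `S`. Completeness of the orthonormal
  -- system is not needed: a contraction suffices for `‖U x‖ ≤ ‖S x‖`.
  obtain ⟨W, hW, hWf⟩ := exists_coefficient_operator (InnerProductSpace.gramSchmidtNormed_orthonormal hv)
  have hent : ∀ i j, entry (W * S) i j = ⟪InnerProductSpace.gramSchmidtNormed ℂ v i, v j⟫_ℂ :=
    fun i j => by rw [entry, mul_apply_eq_comp, hWf]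
  refine ⟨W * S, fun x => hW _, fun i j hij => ?_, fun j => ?_⟩
  · rw [hent, InnerProductSpace.gramSchmidtNormed, inner_smul_left,
      InnerProductSpace.gramSchmidt_inv_triangular ℂ v hij, mul_zero]
  · set g := InnerProductSpace.gramSchmidt ℂ v j with hg
    have hmem : v j - g ∈ Submodule.span ℂ (v '' Set.Iio j) := by
      rw [← InnerProductSpace.span_gramSchmidt_Iio ℂ v j]
      have := InnerProductSpace.gramSchmidt_def' ℂ v j
      rw [← hg] at this
      rw [sub_eq_of_eq_add' this]
      refine Submodule.sum_mem _ fun i hi => ?_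
      have h1 := Submodule.starProjection_apply_mem
        (ℂ ∙ InnerProductSpace.gramSchmidt ℂ v i) (v j)
      refine Submodule.span_mono ?_ h1
      rw [Set.singleton_subset_iff]
      exact ⟨i, Finset.mem_Iio.mp hi, rfl⟩
    have horth : ⟪g, v j - g⟫_ℂ = 0 := by
      refine Submodule.span_induction (p := fun y _ => ⟪g, y⟫_ℂ = 0) ?_ (inner_zero_right _)
        (fun x y _ _ hx hy => by rw [inner_add_right, hx, hy, add_zero])
        (fun a x _ hx => by rw [inner_smul_right, hx, mul_zero]) hmem
      rintro _ ⟨i, hi, rfl⟩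
      exact InnerProductSpace.gramSchmidt_inv_triangular ℂ v hi
    have hgv : ⟪g, v j⟫_ℂ = (‖g‖ : ℂ) ^ 2 := by
      rw [inner_sub_right, sub_eq_zero] at horth
      rw [horth]
      exact inner_self_eq_norm_sq_to_K g
    have hgne : (‖g‖ : ℂ) ≠ 0 := by
      simpa using InnerProductSpace.gramSchmidt_ne_zero j hv
    have hnorm : ‖entry (W * S) j j‖ = ‖g‖ := by
      rw [hent, InnerProductSpace.gramSchmidtNormed, ← hg, inner_smul_left, hgv]
      simp only [map_inv₀, Complex.conj_ofReal, RCLike.ofReal_eq_complex_ofReal]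
      rw [pow_two, inv_mul_cancel_left₀ hgne]
      simp
    -- Earlier basis vectors have zero `j`-th coordinate, so `g = S (e j - x)` has the form to which
    -- `hc` applies.
    obtain ⟨x, hx, hSx⟩ : ∃ x : L2N, x j = 0 ∧ S x = v j - g := by
      refine Submodule.span_induction (p := fun y _ => ∃ x : L2N, x j = 0 ∧ S x = y) ?_
        ⟨0, rfl, map_zero S⟩ ?_ ?_ hmem
      · rintro _ ⟨i, hi, rfl⟩
        exact ⟨e i, by rw [e_apply, if_neg (ne_of_gt hi)], rfl⟩
      · rintro _ _ _ _ ⟨x, hx, rfl⟩ ⟨y, hy, rfl⟩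
        exact ⟨x + y, by simp [hx, hy], map_add S x y⟩
      · rintro a _ _ ⟨x, hx, rfl⟩
        exact ⟨a • x, by simp [hx], map_smul S a x⟩
    have hSg : S (e j - x) = g := by rw [map_sub, hSx]; exact sub_sub_cancel _ _
    rw [hnorm, ← hSg]
    exact hc j x hx

theorem exists_sqrt {E : Type*} [NormedAddCommGroup E] [InnerProductSpace ℂ E] [CompleteSpace E]
    (R : E →L[ℂ] E) (hR : R.IsPositive) :
    ∃ S : E →L[ℂ] E, ∀ x, ‖S x‖ ^ 2 = (⟪R x, x⟫_ℂ).re := by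
  have h0 : 0 ≤ R := (ContinuousLinearMap.nonneg_iff_isPositive R).mpr hR
  refine ⟨CFC.sqrt R, fun x => ?_⟩
  have h1 : IsSelfAdjoint (CFC.sqrt R) := (CFC.sqrt_nonneg R).isSelfAdjoint
  have h2 : ⟪R x, x⟫_ℂ = ⟪CFC.sqrt R x, CFC.sqrt R x⟫_ℂ := by
    conv_lhs => rw [← CFC.sqrt_mul_sqrt_self R h0]
    exact h1.isSymmetric _ _
  rw [h2]
  exact (inner_self_eq_norm_sq (𝕜 := ℂ) _).symm

theorem abs_re_inner_apply_le {H : BL2N} (h1 : ‖H‖ ≤ 1) (x : L2N) :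
    |(⟪H x, x⟫_ℂ).re| ≤ ‖x‖ ^ 2 := by
  refine (Complex.abs_re_le_norm _).trans ((norm_inner_le_norm _ _).trans ?_)
  have := H.le_of_opNorm_le h1 x
  nlinarith [norm_nonneg x]

/-- The quadratic form of `1 + s H` on vectors `eⱼ - x` with `x ⊥ eⱼ`. -/
theorem le_quadraticForm_e_sub {H : BL2N} (hH : IsSelfAdjoint H) (h0 : condExpDiag H = 0)
    (h1 : ‖H‖ ≤ 1) {s : ℝ} (hs : 0 ≤ s) (hs2 : s ≤ 1 / 2) (j : ℕ) (x : L2N) (hx : x j = 0) :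
    1 - 2 * s ^ 2 ≤ ‖e j - x‖ ^ 2 + s * (⟪H (e j - x), e j - x⟫_ℂ).re := by
  have hjj : ⟪H (e j), e j⟫_ℂ = 0 := by
    rw [← inner_conj_symm, ← entry_eq_inner, (condExpDiag_eq_zero_iff H).mp h0 j, map_zero]
  have hn : ‖e j - x‖ ^ 2 = 1 + ‖x‖ ^ 2 := by
    rw [@norm_sub_sq ℂ, inner_e_left, hx, norm_e]
    simp
  have hsym : (⟪H x, e j⟫_ℂ).re = (⟪H (e j), x⟫_ℂ).re := by
    have h2 : ⟪H x, e j⟫_ℂ = ⟪x, H (e j)⟫_ℂ := hH.isSymmetric x (e j)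
    rw [h2, ← inner_conj_symm, Complex.conj_re]
  have hq : (⟪H (e j - x), e j - x⟫_ℂ).re = (⟪H x, x⟫_ℂ).re - 2 * (⟪H (e j), x⟫_ℂ).re := by
    rw [map_sub, inner_sub_left, inner_sub_right, inner_sub_right, hjj]
    simp only [Complex.sub_re, Complex.zero_re, hsym]
    ring
  have hb1 := abs_le.mp (abs_re_inner_apply_le h1 x)
  have hb2 : (⟪H (e j), x⟫_ℂ).re ≤ ‖x‖ := by
    refine (Complex.re_le_norm _).trans ((norm_inner_le_norm _ _).trans ?_)
    have := H.le_of_opNorm_le h1 (e j)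
    rw [norm_e] at this
    nlinarith [norm_nonneg x]
  rw [hn, hq]
  have hb3 := mul_le_mul_of_nonneg_left hb1.1 hs
  have hb4 := mul_le_mul_of_nonneg_left hb2 hs
  -- Completing the square: `1 + (1 - s)‖x‖² - 2s‖x‖ ≥ 1 - 2s² + (‖x‖ - 2s)²/2`.
  nlinarith [sq_nonneg (‖x‖ - 2 * s), mul_nonneg (sub_nonneg.mpr hs2) (sq_nonneg ‖x‖)]

/-- Triangular factorization of `1 + s H`, split into diagonal and strictly upper triangular part. -/
theorem exists_strictlyUpperTriangular_minorant {H : BL2N} (hH : IsSelfAdjoint H)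
    (h0 : condExpDiag H = 0) (h1 : ‖H‖ ≤ 1) {s : ℝ} (hs : 0 ≤ s) (hs2 : s ≤ 1 / 2) :
    ∃ T ∈ strictlyUpperTriangular, ∃ d : LInfN, ‖T‖ ≤ 4 ∧ (∀ i, 1 - 2 * s ^ 2 ≤ ‖d i‖ ^ 2) ∧
      ∀ x, ‖(diagOp d + T) x‖ ^ 2 ≤ ‖x‖ ^ 2 + s * (⟪H x, x⟫_ℂ).re := by
  set R : BL2N := 1 + (s : ℂ) • H with hRdef
  have hform : ∀ x, (⟪R x, x⟫_ℂ).re = ‖x‖ ^ 2 + s * (⟪H x, x⟫_ℂ).re := by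
    intro x
    have h2 : (⟪x, x⟫_ℂ).re = ‖x‖ ^ 2 := inner_self_eq_norm_sq (𝕜 := ℂ) x
    simp only [hRdef, add_apply, one_apply_eq_self,
      smul_apply, inner_add_left, inner_smul_left, Complex.conj_ofReal,
      Complex.add_re, Complex.re_ofReal_mul, h2]
  have hlow : ∀ x, 1 / 2 * ‖x‖ ^ 2 ≤ (⟪R x, x⟫_ℂ).re := by
    intro x
    rw [hform]
    have := mul_le_mul_of_nonneg_left (abs_le.mp (abs_re_inner_apply_le h1 x)).1 hs
    nlinarith [mul_nonneg (sub_nonneg.mpr hs2) (sq_nonneg ‖x‖)]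
  have hRsa : IsSelfAdjoint R := by
    refine (IsSelfAdjoint.one _).add (IsSelfAdjoint.smul ?_ hH)
    rw [isSelfAdjoint_iff]
    exact Complex.conj_ofReal s
  have hRpos : R.IsPositive := by
    rw [ContinuousLinearMap.isPositive_def']
    refine ⟨hRsa, fun x => ?_⟩
    rw [ContinuousLinearMap.reApplyInnerSelf_apply]
    exact le_trans (by positivity) (hlow x)
  obtain ⟨S, hS⟩ := exists_sqrt R hRpos
  have hSinj : Function.Injective S := by
    rw [injective_iff_map_eq_zero]
    intro x hx
    have h2 := hlow x
    rw [← hS, hx, norm_zero] at h2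
    have h3 : ‖x‖ ^ 2 = 0 := le_antisymm (by linarith) (sq_nonneg _)
    simpa using h3
  obtain ⟨U, hU, htri, hdiag⟩ := exists_upperTriangular_factor S hSinj
    (c := 1 - 2 * s ^ 2) (fun j x hx => by
      rw [hS, hform]
      exact le_quadraticForm_e_sub hH h0 h1 hs hs2 j x hx)
  have hUle : ∀ x, ‖U x‖ ^ 2 ≤ ‖x‖ ^ 2 + s * (⟪H x, x⟫_ℂ).re := by
    intro x
    rw [← hform, ← hS]
    exact pow_le_pow_left₀ (norm_nonneg _) (hU x) 2
  have hUnorm : ‖U‖ ≤ 2 := by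
    refine U.opNorm_le_bound (by norm_num) fun x => ?_
    refine abs_le_of_sq_le_sq' ?_ (by positivity) |>.2
    have := mul_le_mul_of_nonneg_left (abs_le.mp (abs_re_inner_apply_le h1 x)).2 hs
    nlinarith [hUle x, mul_nonneg (sub_nonneg.mpr hs2) (sq_nonneg ‖x‖), sq_nonneg ‖x‖]
  refine ⟨U - condExpDiag U, fun i j hij => ?_, diagSeq U, ?_, hdiag, fun x => ?_⟩
  · rw [entry_sub, entry_condExpDiag]
    split_ifs with h
    · rw [h, sub_self]
    · rw [htri i j (lt_of_le_of_ne hij (Ne.symm h)), sub_zero]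
  · calc ‖U - condExpDiag U‖ ≤ ‖U‖ + ‖condExpDiag U‖ := norm_sub_le _ _
      _ ≤ 2 + 2 := add_le_add hUnorm ((condExpDiag_norm_le U).trans hUnorm)
      _ = 4 := by norm_num
  · have : diagOp (diagSeq U) + (U - condExpDiag U) = U := add_sub_cancel _ _
    rw [this]
    exact hUle x

/-! ### From triangular pavings to self-adjoint pavings -/

/-- A small compression of the strictly triangular part bounds the quadratic form from below. -/
theorem neg_le_of_norm_compression_le {H T : BL2N} {d : LInfN} {A : Set ℕ} {s η : ℝ}
    (h1 : ‖H‖ ≤ 1) (hs : 0 ≤ s) (hs2 : s ≤ 1 / 2) (hη : 0 ≤ η) (hη1 : η ≤ 1)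
    (hd : ∀ i, 1 - 2 * s ^ 2 ≤ ‖d i‖ ^ 2)
    (hU : ∀ x, ‖(diagOp d + T) x‖ ^ 2 ≤ ‖x‖ ^ 2 + s * (⟪H x, x⟫_ℂ).re)
    (hT : ‖proj A * T * proj A‖ ≤ η) (x : L2N) (hx : proj A x = x) :
    -((2 * s ^ 2 + 5 * η) * ‖x‖ ^ 2) ≤ s * (⟪H x, x⟫_ℂ).re := by
  set u := ‖(diagOp d + T) x‖ with hu
  have hDx : proj A (diagOp d x) = diagOp d x := by
    rw [← mul_apply_eq_comp, proj_commute_diagOp, mul_apply_eq_comp, hx]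
  have hsplit : diagOp d x = proj A ((diagOp d + T) x) - (proj A * T * proj A) x := by
    simp only [mul_apply_eq_comp, add_apply, map_add, hx, hDx]
    abel
  have hle : ‖diagOp d x‖ ≤ u + η * ‖x‖ := by
    rw [hsplit]
    refine (norm_sub_le _ _).trans (add_le_add ?_ (ContinuousLinearMap.le_of_opNorm_le _ hT x))
    exact ((proj A).le_of_opNorm_le (proj_norm_le A) _).trans_eq (one_mul _)
  have hu0 : 0 ≤ u := norm_nonneg _
  have hx0 := norm_nonneg x
  have hu2 : u ≤ 2 * ‖x‖ := by
    refine abs_le_of_sq_le_sq' ?_ (by positivity) |>.2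
    have := mul_le_mul_of_nonneg_left (abs_le.mp (abs_re_inner_apply_le h1 x)).2 hs
    nlinarith [hU x, mul_nonneg (sub_nonneg.mpr hs2) (sq_nonneg ‖x‖), sq_nonneg ‖x‖]
  -- The cross term contributes `4η` because `u ≤ 2‖x‖`, and `η² ≤ η` contributes the rest.
  have hsq : ‖diagOp d x‖ ^ 2 ≤ u ^ 2 + 5 * η * ‖x‖ ^ 2 := by
    have h2 : ‖diagOp d x‖ ^ 2 ≤ (u + η * ‖x‖) ^ 2 := pow_le_pow_left₀ (norm_nonneg _) hle 2
    have h3 : η * ‖x‖ * u ≤ η * ‖x‖ * (2 * ‖x‖) :=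
      mul_le_mul_of_nonneg_left hu2 (mul_nonneg hη hx0)
    have h4 : η * η * ‖x‖ ^ 2 ≤ 1 * η * ‖x‖ ^ 2 := by gcongr
    nlinarith
  have := le_norm_sq_diagOp d hd x
  have := hU x
  nlinarith

theorem exists_paving_quadraticForm_ge {ε : ℝ} (hε : 0 < ε) (hε1 : ε ≤ 1) {r : ℕ}
    (hr : ∀ T : BL2N, T ∈ strictlyUpperTriangular → ∃ A : Fin r → Set ℕ, IsPaving A ∧
      ∀ i, ‖proj (A i) * T * proj (A i)‖ ≤ ε ^ 2 / 160 * ‖T‖)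
    {H : BL2N} (hH : IsSelfAdjoint H) (h0 : condExpDiag H = 0) (h1 : ‖H‖ ≤ 1) :
    ∃ A : Fin r → Set ℕ, IsPaving A ∧
      ∀ i x, proj (A i) x = x → -(ε * ‖x‖ ^ 2) ≤ (⟪H x, x⟫_ℂ).re := by
  -- With `s = ε/4` and `η = 4 · ε²/160 = ε²/40`, the terms `2s` and `5η/s` are each `ε/2`.
  have hs : (0 : ℝ) < ε / 4 := by positivity
  have hs2 : ε / 4 ≤ 1 / 2 := by linarith
  obtain ⟨T, hT, d, hT4, hd, hU⟩ := exists_strictlyUpperTriangular_minorant hH h0 h1 hs.le hs2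
  obtain ⟨A, hA, hAT⟩ := hr T hT
  refine ⟨A, hA, fun i x hx => ?_⟩
  have hη : ‖proj (A i) * T * proj (A i)‖ ≤ ε ^ 2 / 40 := by
    refine (hAT i).trans ?_
    nlinarith [sq_nonneg ε]
  have := neg_le_of_norm_compression_le h1 hs.le hs2 (by positivity) (by nlinarith) hd hU hη x hx
  refine le_of_mul_le_mul_left ?_ hs
  refine le_trans (le_of_eq ?_) this
  ring

theorem exists_paving_of_strictlyUpperTriangular {ε : ℝ} (hε : 0 < ε) (hε1 : ε ≤ 1) {r : ℕ}
    (hr : ∀ T : BL2N, T ∈ strictlyUpperTriangular → ∃ A : Fin r → Set ℕ, IsPaving A ∧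
      ∀ i, ‖proj (A i) * T * proj (A i)‖ ≤ ε ^ 2 / 160 * ‖T‖)
    {H : BL2N} (hH : IsSelfAdjoint H) (h0 : condExpDiag H = 0) :
    ∃ A : Fin (r * r) → Set ℕ, IsPaving A ∧
      ∀ i, ‖proj (A i) * H * proj (A i)‖ ≤ ε * ‖H‖ := by
  -- For `H = 0` the inverse is `0`, so `K = 0` and no separate case is needed below.
  set K : BL2N := ((‖H‖⁻¹ : ℝ) : ℂ) • H with hKdef
  have hKsa : IsSelfAdjoint K := IsSelfAdjoint.smul (Complex.conj_ofReal _) hH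
  have hK0 : ∀ i, entry K i i = 0 := fun i => by
    rw [entry_smul, (condExpDiag_eq_zero_iff H).mp h0 i, mul_zero]
  have hK1 : ‖K‖ ≤ 1 := by
    rw [hKdef, norm_smul, Complex.norm_real, norm_inv, norm_norm]
    exact inv_mul_le_one
  have hHK : H = (‖H‖ : ℂ) • K := by
    rcases eq_or_ne H 0 with rfl | hne
    · simp
    · have : (‖H‖ : ℂ) ≠ 0 := by simpa using hne
      rw [hKdef, Complex.ofReal_inv, smul_inv_smul₀ this]
  obtain ⟨A, hA, hAK⟩ := exists_paving_quadraticForm_ge hε hε1 hr hKsa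
    ((condExpDiag_eq_zero_iff K).mpr hK0) hK1
  obtain ⟨B, hB, hBK⟩ := exists_paving_quadraticForm_ge hε hε1 hr (H := -K) hKsa.neg
    ((condExpDiag_eq_zero_iff _).mpr fun i => by
      rw [← neg_one_smul ℂ K, entry_smul, hK0, mul_zero]) (by rwa [norm_neg])
  refine ⟨refinement A B, hA.refinement hB, fun i => ?_⟩
  have hle : ‖proj (refinement A B i) * K * proj (refinement A B i)‖ ≤ ε := by
    refine norm_compression_le hKsa _ hε.le fun x hx => ?_
    have hxA : proj (A (finProdFinEquiv.symm i).1) x = x := by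
      conv_lhs => rw [← hx]
      rw [← mul_apply_eq_comp, ← proj_inter, refinement, ← Set.inter_assoc,
        Set.inter_self]
      exact hx
    have hxB : proj (B (finProdFinEquiv.symm i).2) x = x := by
      conv_lhs => rw [← hx]
      rw [← mul_apply_eq_comp, ← proj_inter, refinement, Set.inter_left_comm,
        Set.inter_self]
      exact hx
    have hb := hBK _ x hxB
    rw [neg_apply, inner_neg_left, Complex.neg_re] at hb
    exact abs_le.mpr ⟨hAK _ x hxA, by linarith⟩
  have heq : proj (refinement A B i) * H * proj (refinement A B i) =
      (‖H‖ : ℂ) • (proj (refinement A B i) * K * proj (refinement A B i)) := by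
    conv_lhs => rw [hHK]
    rw [mul_smul_comm, smul_mul_assoc]
  rw [heq, norm_smul, Complex.norm_real, norm_norm, mul_comm]
  exact mul_le_mul_of_nonneg_right hle (norm_nonneg _)

-- Taking real and imaginary parts does not increase the norm, so two errors of `ε/2` add up to `ε`
-- on the common refinement.
open ComplexStarModule in
theorem exists_paving_of_selfAdjoint {ε : ℝ} {r : ℕ}
    (hr : ∀ H : BL2N, IsSelfAdjoint H → condExpDiag H = 0 → ∃ A : Fin r → Set ℕ, IsPaving A ∧
      ∀ i, ‖proj (A i) * H * proj (A i)‖ ≤ ε / 2 * ‖H‖) (hε : 0 < ε)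
    {T : BL2N} (hT : condExpDiag T = 0) :
    ∃ A : Fin (r * r) → Set ℕ, IsPaving A ∧
      ∀ i, ‖proj (A i) * T * proj (A i)‖ ≤ ε * ‖T‖ := by
  rw [condExpDiag_eq_zero_iff] at hT
  have hre : (ℜ T : BL2N) = (2⁻¹ : ℂ) • (T + star T) := by
    rw [realPart_apply_coe, ← Complex.coe_smul]
    norm_num
  have him : (ℑ T : BL2N) = (-Complex.I * 2⁻¹ : ℂ) • (T - star T) := by
    rw [imaginaryPart_apply_coe, ← Complex.coe_smul, smul_smul]
    norm_num
  obtain ⟨A, hA, hAT⟩ := hr (ℜ T : BL2N) (ℜ T).2 ((condExpDiag_eq_zero_iff _).mpr fun i => by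
    rw [hre, entry_smul, entry_add, entry_star, hT]; simp)
  obtain ⟨B, hB, hBT⟩ := hr (ℑ T : BL2N) (ℑ T).2 ((condExpDiag_eq_zero_iff _).mpr fun i => by
    rw [him, entry_smul, entry_sub, entry_star, hT]; simp)
  refine ⟨refinement A B, hA.refinement hB, fun i => ?_⟩
  have h1 := (norm_compression_inter_le_left (A (finProdFinEquiv.symm i).1)
    (B (finProdFinEquiv.symm i).2) (ℜ T : BL2N)).trans (hAT _)
  have h2 := (norm_compression_inter_le_right (A (finProdFinEquiv.symm i).1)
    (B (finProdFinEquiv.symm i).2) (ℑ T : BL2N)).trans (hBT _)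
  have h3 : ‖(ℜ T : BL2N)‖ ≤ ‖T‖ := realPart.norm_le T
  have h4 : ‖(ℑ T : BL2N)‖ ≤ ‖T‖ := imaginaryPart.norm_le T
  have heq : proj (refinement A B i) * T * proj (refinement A B i) =
      proj (refinement A B i) * (ℜ T : BL2N) * proj (refinement A B i) +
      Complex.I • (proj (refinement A B i) * (ℑ T : BL2N) * proj (refinement A B i)) := by
    conv_lhs => rw [← realPart_add_I_smul_imaginaryPart T]
    rw [mul_add, add_mul, mul_smul_comm, smul_mul_assoc]
  rw [heq]
  refine (norm_add_le _ _).trans ?_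
  rw [norm_smul, Complex.norm_I, one_mul]
  refine (add_le_add h1 h2).trans ?_
  nlinarith

end Paving

theorem mainTheorem3 :
    (∀ ε : ℝ, 0 < ε → ∃ r₁ : ℕ, ∀ H : Paving.BL2N, IsSelfAdjoint H → Paving.condExpDiag H = 0 →
      ∃ A : Fin r₁ → Set ℕ, Paving.IsPaving A ∧
        ∀ i, ‖Paving.proj (A i) * H * Paving.proj (A i)‖ ≤ ε * ‖H‖) ↔
    (∀ ε : ℝ, 0 < ε → ∃ r₂ : ℕ, ∀ T : Paving.BL2N, T ∈ Paving.strictlyUpperTriangular →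
      ∃ A : Fin r₂ → Set ℕ, Paving.IsPaving A ∧
        ∀ i, ‖Paving.proj (A i) * T * Paving.proj (A i)‖ ≤ ε * ‖T‖) := by
  constructor
  · intro h ε hε
    obtain ⟨r, hr⟩ := h (ε / 2) (by positivity)
    refine ⟨r * r, fun T hT => Paving.exists_paving_of_selfAdjoint hr hε ?_⟩
    exact (Paving.condExpDiag_eq_zero_iff T).mpr fun i => hT i i le_rfl
  · intro h ε hε
    -- Capping at `1` keeps `s = ε/4 ≤ 1/2` and `η ≤ 1` in the perturbation estimates.
    have hδ : 0 < min ε 1 := lt_min hε one_pos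
    obtain ⟨r, hr⟩ := h ((min ε 1) ^ 2 / 160) (by positivity)
    refine ⟨r * r, fun H hH h0 => ?_⟩
    obtain ⟨A, hA, hAH⟩ :=
      Paving.exists_paving_of_strictlyUpperTriangular hδ (min_le_right _ _) hr hH h0
    exact ⟨A, hA, fun i => (hAH i).trans
      (mul_le_mul_of_nonneg_right (min_le_left _ _) (norm_nonneg _))⟩
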